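/- A layered algebraic branching program (ABP) over a field $F$ in variables $x_1,\dots,x_n$ is a finite directed graph whose vertices are partitioned into consecutive layers, whose edges only go from one layer to the next, whose first and last layers consist of one vertex each (the start and the end vertex), and whose edges are labelled by polynomials in $F[x_1,\dots,x_n]$. It computes the sum, over all directed paths from the start to the end vertex, of the product of the edge labels along the path; its size is its number of vertices. There is an absolute constant $c>0$ such that the following holds for every field $F$ and every $n\in\mathbb{N}$ with $\operatorname{char}(F)\nmid n$. 1. Every layered ABP over $F$ whose edge labels are affine linear forms (polynomials of degree at most $1$) and which computes $\sum_{i=1}^n x_i^n$ has size at least $c\,n^2$. 2. For every integer $\Delta$ with $1\le\Delta<n$, every layered ABP over $F$ whose edge labels are polynomials of degree at most $\Delta$ and which computes $\sum_{i=1}^n x_i^n$ has size at least $c\,n^2/\Delta$. -/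

import Mathlib

/-- A layered algebraic branching program over `F` in the variables `σ`, with vertex set `V`:
a directed graph whose vertices are split into the layers `0, …, depth`, whose edges go from a
layer to the next one, whose first layer is `{start}` and whose last layer is `{finish}`, and whose
edges are labelled by polynomials. The value `label u v` plays no role unless `u → v` is an edge. -/
structure ABP (F : Type*) [Field F] (σ : Type*) (V : Type*) extends Digraph V where
  depth : ℕ
  layer : V → ℕ
  start : V
  finish : V
  layer_le_depth : ∀ v, layer v ≤ depth
  layer_eq_zero_iff : ∀ v, layer v = 0 ↔ v = start
  layer_eq_depth_iff : ∀ v, layer v = depth ↔ v = finish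
  layer_of_adj : ∀ u v, Adj u v → layer v = layer u + 1
  label : V → V → MvPolynomial σ F

namespace ABP

variable {F : Type*} [Field F] {σ V : Type*}

/-- `p` lists the vertices of a directed path from the start to the end vertex. As every edge goes
up by one layer, each such path has exactly `depth` edges. -/
def IsPath (A : ABP F σ V) (p : Fin (A.depth + 1) → V) : Prop :=
  p 0 = A.start ∧ p (Fin.last A.depth) = A.finish ∧
    ∀ i : Fin A.depth, A.Adj (p i.castSucc) (p i.succ)

/-- The weight of a path: the product of the labels of its edges. -/
noncomputable def weight (A : ABP F σ V) (p : Fin (A.depth + 1) → V) : MvPolynomial σ F :=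
  ∏ i : Fin A.depth, A.label (p i.castSucc) (p i.succ)

open Classical in
/-- The polynomial computed by the program: the sum of the weights of all paths from the start
to the end vertex. -/
noncomputable def computed [Fintype V] (A : ABP F σ V) : MvPolynomial σ F :=
  ∑ p : Fin (A.depth + 1) → V with A.IsPath p, A.weight p

/-- The size of a program: its number of vertices. -/
def size [Fintype V] (_A : ABP F σ V) : ℕ := Fintype.card V

/-- All edge labels have (total) degree at most `Δ`. -/
def LabelsDegreeLE (A : ABP F σ V) (Δ : ℕ) : Prop :=
  ∀ u v, A.Adj u v → (A.label u v).totalDegree ≤ Δ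

/-- All edge labels are affine linear forms, that is, polynomials of degree at most one. -/
def LabelsAffine (A : ABP F σ V) : Prop := A.LabelsDegreeLE 1

end ABP

/-! ### Algebra: few products cannot give the power sum up to low degree. -/

namespace MvPolynomial

variable {F σ : Type*} [Field F]

/-! Cut the program at every `t`-th layer, with the offset chosen so that at most size/`t` vertices
are hit. Splitting off constant terms at the cuts writes the output as `∑ P v * Q v + R`, one
product per cut vertex, all factors vanishing at the origin, and `R` of degree at most `Δ * t < n`
(`exists_computed_eq_sum_mul_add`). If this is the power sum, its partial derivatives show that each
`X i ^ (n - 1)` is, modulo the ideal of all `P v`, `Q v`, of degree below `n - 1`. So these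
polynomials have a finite-dimensional quotient yet vanish at the origin; by Krull's height theorem
there are at least `n` of them (`le_card_of_finite_quotient`). Thus size/`t` is at least `n / 2`,
with `t` about `n / Δ`. -/

theorem totalDegree_pderiv_le {R : Type*} [CommSemiring R] (i : σ) (p : MvPolynomial σ R) :
    (pderiv i p).totalDegree ≤ p.totalDegree - 1 := by
  classical
  refine Finset.sup_le fun m hm => ?_
  rw [mem_support_iff, coeff_pderiv] at hm
  have hmem : m + Finsupp.single i 1 ∈ p.support := by
    rw [mem_support_iff]
    intro h
    simp [h] at hm
  have := le_totalDegree hmem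
  rw [Finsupp.sum_add_index' (fun _ => rfl) (fun _ _ _ => rfl)] at this
  simp only [Finsupp.sum_single_index] at this
  omega

/-- If modulo `J` a power of each variable agrees with a polynomial of smaller degree, then the
quotient by `J` is finite-dimensional. -/
theorem finite_quotient_of_X_pow_sub_mem [Finite σ] (J : Ideal (MvPolynomial σ F)) (e : ℕ)
    (h : σ → MvPolynomial σ F) (hdeg : ∀ i, (h i).totalDegree < e)
    (hJ : ∀ i, X i ^ e - h i ∈ J) : Module.Finite F (MvPolynomial σ F ⧸ J) := by
  classical
  let q := (Ideal.Quotient.mkₐ F J).toLinearMap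
  let S : Set (σ →₀ ℕ) := {s | ∀ i, s i < e}
  have hS : S.Finite := (Set.finite_Iic (Finsupp.equivFunOnFinite.symm fun _ : σ => e)).subset
    fun s hs i => (hs i).le
  let W : Submodule F (MvPolynomial σ F ⧸ J) :=
    Submodule.span F ((fun s => q (monomial s 1)) '' S)
  have of_support : ∀ f : MvPolynomial σ F,
      (∀ s ∈ f.support, q (monomial s 1) ∈ W) → q f ∈ W := by
    intro f hf
    rw [f.as_sum, map_sum]
    refine W.sum_mem fun s hs => ?_
    have : monomial s (coeff s f) = coeff s f • (monomial s 1 : MvPolynomial σ F) := by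
      rw [smul_monomial, smul_eq_mul, mul_one]
    rw [this, map_smul]
    exact W.smul_mem _ (hf s hs)
  -- Replacing a factor `X i ^ e` by `h i` strictly lowers the degree, so the reduction to exponents
  -- below `e` terminates.
  have key : ∀ (d : ℕ) (s : σ →₀ ℕ), s.degree = d → q (monomial s 1) ∈ W := by
    intro d
    induction d using Nat.strong_induction_on with
    | _ d ih =>
      intro s hs
      by_cases hsS : s ∈ S
      · exact Submodule.subset_span ⟨s, hsS, rfl⟩
      · obtain ⟨i, hi⟩ : ∃ i, e ≤ s i := by simpa [S] using hsS
        have hle : Finsupp.single i e ≤ s := by simpa using hi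
        obtain ⟨u, rfl⟩ := exists_add_of_le hle
        have hdu : d = e + u.degree := by rw [← hs, map_add, Finsupp.degree_single]
        have heq : q (monomial (Finsupp.single i e + u) 1) = q (h i * monomial u 1) := by
          refine Ideal.Quotient.eq.2 ?_
          have : monomial (Finsupp.single i e + u) (1 : F) = X i ^ e * monomial u 1 := by
            rw [X_pow_eq_monomial, monomial_mul, one_mul]
          rw [this, ← sub_mul]
          exact J.mul_mem_right _ (hJ i)
        rw [heq]
        refine of_support _ fun s' hs' => ih s'.degree ?_ s' rfl
        have h1 : s'.degree ≤ (h i * monomial u (1 : F)).totalDegree := le_totalDegree hs'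
        have h2 := totalDegree_mul (h i) (monomial u (1 : F))
        have h3 : (monomial u (1 : F)).totalDegree ≤ u.degree := totalDegree_monomial_le u 1
        have h4 := hdeg i
        omega
  have htop : W = ⊤ := by
    refine Submodule.eq_top_iff'.2 fun x => ?_
    obtain ⟨f, rfl⟩ := Ideal.Quotient.mk_surjective x
    exact of_support f fun s _ => key _ s rfl
  exact ⟨htop ▸ Submodule.fg_span (hS.image _)⟩

/-- The ideal of the origin of affine `n`-space has height at least `n`. -/
theorem le_height_ker_constantCoeff (n : ℕ) :
    (n : ℕ∞) ≤ (RingHom.ker (constantCoeff : MvPolynomial (Fin n) F →+* F)).height := by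
  -- `φ k` kills the first `k` variables; the kernels form a strict chain of primes below the ideal
  -- of the origin.
  let φ : ℕ → MvPolynomial (Fin n) F →ₐ[F] MvPolynomial (Fin n) F :=
    fun k => aeval fun i => if (i : ℕ) < k then 0 else X i
  have hmono : ∀ k, RingHom.ker (φ k) ≤ RingHom.ker (φ (k + 1)) := by
    intro k f hf
    have hcomp : φ (k + 1) = (φ (k + 1)).comp (φ k) := by
      ext i : 1
      by_cases h1 : (i : ℕ) < k
      · simp [φ, h1, h1.le]
      · simp [φ, h1]
    rw [RingHom.mem_ker] at hf ⊢
    rw [hcomp, AlgHom.comp_apply, hf, map_zero]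
  have hlt : ∀ k < n, RingHom.ker (φ k) < RingHom.ker (φ (k + 1)) := by
    intro k hk
    refine lt_of_le_of_ne (hmono k) fun heq => ?_
    have : X ⟨k, hk⟩ ∈ RingHom.ker (φ k) := by
      rw [heq, RingHom.mem_ker]
      simp [φ]
    rw [RingHom.mem_ker] at this
    simp [φ] at this
  have hprime : ∀ k, (RingHom.ker (φ k)).IsPrime := fun k => RingHom.ker_isPrime _
  have hheight : ∀ k ≤ n, (k : ℕ∞) ≤ (RingHom.ker (φ k)).height := by
    intro k
    induction k with
    | zero => simp
    | succ k ih =>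
      intro hk
      have := Ideal.height_add_one_le_of_lt_of_isPrime (hlt k hk)
      push_cast
      exact (add_le_add_left (ih (by omega)) 1).trans this
  refine (hheight n le_rfl).trans (Ideal.height_mono fun f hf => ?_)
  have hcomp : constantCoeff.comp (φ n : MvPolynomial (Fin n) F →+* MvPolynomial (Fin n) F) =
      constantCoeff := by
    ext i
    · simp [φ]
    · simp [φ]
  rw [RingHom.mem_ker] at hf ⊢
  rw [← hcomp, RingHom.comp_apply]
  erw [hf]
  exact map_zero _

/-- If the zero set of `s` contains the origin and has a finite-dimensional coordinate ring, then
`s` has at least as many elements as there are variables. -/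
theorem le_card_of_finite_quotient {n : ℕ} (s : Finset (MvPolynomial (Fin n) F))
    (hs : ∀ f ∈ s, constantCoeff f = 0)
    (hfin : Module.Finite F (MvPolynomial (Fin n) F ⧸ Ideal.span (s : Set (MvPolynomial _ F)))) :
    n ≤ s.card := by
  set J := Ideal.span (s : Set (MvPolynomial (Fin n) F))
  let m := RingHom.ker (constantCoeff : MvPolynomial (Fin n) F →+* F)
  have hmprime : m.IsPrime := RingHom.ker_isPrime _
  have hJm : J ≤ m := Ideal.span_le.2 hs
  have hmin : m ∈ J.minimalPrimes := by
    refine ⟨⟨hmprime, hJm⟩, ?_⟩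
    rintro p ⟨hp, hJp⟩ hpm
    -- A domain finite over a field is a field, so `p` is maximal and equals `m`.
    have : Module.Finite F (MvPolynomial (Fin n) F ⧸ p) :=
      Module.Finite.of_surjective (Ideal.Quotient.factorₐ F hJp).toLinearMap
        (Ideal.Quotient.factor_surjective hJp)
    have hmax : p.IsMaximal := Ideal.Quotient.maximal_of_isField _
      (isField_of_isIntegral_of_isField' (Field.toIsField F))
    exact (hmax.eq_of_le hmprime.ne_top hpm).ge
  exact_mod_cast (le_height_ker_constantCoeff n).trans
    (Ideal.height_le_card_of_mem_minimalPrimes_span_finset hmin)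

/-- A lower bound for the number of products of polynomials vanishing at the origin whose sum is
the power sum, up to terms of lower degree. -/
theorem le_two_mul_card_of_sum_X_pow_eq {n : ℕ} (hn : 2 ≤ n) (hchar : (n : F) ≠ 0)
    {ι : Type*} (K : Finset ι) (P Q : ι → MvPolynomial (Fin n) F) (R : MvPolynomial (Fin n) F)
    (hP : ∀ v, constantCoeff (P v) = 0) (hQ : ∀ v, constantCoeff (Q v) = 0)
    (hR : R.totalDegree < n) (h : ∑ i : Fin n, X i ^ n = ∑ v ∈ K, P v * Q v + R) :
    n ≤ 2 * K.card := by
  classical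
  let s := K.image P ∪ K.image Q
  have hcard : s.card ≤ 2 * K.card := by
    have : s.card ≤ _ := Finset.card_union_le (K.image P) (K.image Q)
    have := Finset.card_image_le (s := K) (f := P)
    have := Finset.card_image_le (s := K) (f := Q)
    omega
  refine le_trans (le_card_of_finite_quotient s ?_ ?_) hcard
  · intro f hf
    simp only [s, Finset.mem_union, Finset.mem_image] at hf
    obtain ⟨v, -, rfl⟩ | ⟨v, -, rfl⟩ := hf
    exacts [hP v, hQ v]
  -- When `R` is constant, the strict degree bound needs `2 ≤ n`.
  · refine finite_quotient_of_X_pow_sub_mem _ (n - 1)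
      (fun i => C (n : F)⁻¹ * pderiv i R) (fun i => ?_) fun i => ?_
    · have h1 := totalDegree_mul (C (n : F)⁻¹) (pderiv i R)
      have h2 := totalDegree_pderiv_le i R
      rw [totalDegree_C] at h1
      omega
    · have hmem : ∀ v ∈ K, P v ∈ Ideal.span (s : Set (MvPolynomial (Fin n) F)) ∧
          Q v ∈ Ideal.span (s : Set (MvPolynomial (Fin n) F)) := fun v hv =>
        ⟨Ideal.subset_span (Finset.mem_coe.2 (Finset.mem_union_left _
          (Finset.mem_image_of_mem _ hv))),
        Ideal.subset_span (Finset.mem_coe.2 (Finset.mem_union_right _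
          (Finset.mem_image_of_mem _ hv)))⟩
      have hpow : pderiv i (∑ j : Fin n, X j ^ n : MvPolynomial (Fin n) F) =
          C (n : F) * X i ^ (n - 1) := by
        rw [map_sum, Finset.sum_eq_single i]
        · simp
        · intro j _ hj
          simp [pderiv_X_of_ne hj]
        · simp
      have hd := congrArg (pderiv i) h
      rw [hpow, map_add, map_sum] at hd
      have heq : X i ^ (n - 1) - C (n : F)⁻¹ * pderiv i R =
          C (n : F)⁻¹ * ∑ v ∈ K, pderiv i (P v * Q v) := by
        rw [eq_sub_of_add_eq hd.symm, mul_sub, ← mul_assoc, ← C_mul, inv_mul_cancel₀ hchar, C_1,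
          one_mul]
      rw [heq]
      refine Ideal.mul_mem_left _ _ (Ideal.sum_mem _ fun v hv => ?_)
      rw [pderiv_mul]
      exact Ideal.add_mem _ (Ideal.mul_mem_left _ _ (hmem v hv).2)
        (Ideal.mul_mem_right _ _ (hmem v hv).1)

end MvPolynomial

/-! ### Averaging over offsets, and walks. -/

open Finset in
/-- Some residue class modulo `t` contains at most the fraction `1 / t` of the values of `f`. -/
theorem Finset.exists_mul_card_dvd_add_le {V : Type*} [Fintype V] (f : V → ℕ) {t : ℕ}
    (ht : 0 < t) : ∃ j, t * (univ.filter fun v => t ∣ f v + j).card ≤ Fintype.card V := by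
  by_contra! h
  have hsum : ∑ j ∈ range t, t * (univ.filter fun v => t ∣ f v + j).card ≤ t * Fintype.card V := by
    rw [← mul_sum]
    refine Nat.mul_le_mul_left t ?_
    simp_rw [card_filter]
    rw [sum_comm, Fintype.card_eq_sum_ones]
    refine sum_le_sum fun v _ => ?_
    rw [← card_filter]
    -- Each vertex is counted for at most one offset below `t`.
    refine card_le_one.2 fun a ha b hb => ?_
    simp only [mem_filter, mem_range] at ha hb
    have hab : a ≡ b [MOD t] := Nat.ModEq.add_left_cancel' (f v)
      ((Nat.modEq_zero_iff_dvd.2 ha.2).trans (Nat.modEq_zero_iff_dvd.2 hb.2).symm)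
    exact hab.eq_of_lt_of_lt ha.1 hb.1
  have hlt : ∑ _j ∈ range t, Fintype.card V < ∑ j ∈ range t, t * (univ.filter fun v => t ∣ f v + j).card :=
    sum_lt_sum_of_nonempty ⟨0, mem_range.2 ht⟩ fun j _ => h j
  rw [sum_const, card_range, smul_eq_mul] at hlt
  omega

/-- The entries of the powers of a matrix as sums over walks. -/
theorem Matrix.pow_apply_eq_sum_walks {V S : Type*} [Fintype V] [DecidableEq V] [CommSemiring S]
    (E : Matrix V V S) (d : ℕ) (s x : V) :
    (E ^ d) s x = ∑ p : Fin (d + 1) → V, if p 0 = s ∧ p (Fin.last d) = x then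
      ∏ i : Fin d, E (p i.castSucc) (p i.succ) else 0 := by
  induction d generalizing s with
  | zero =>
    rw [← (Equiv.funUnique (Fin 1) V).symm.sum_comp]
    simp only [pow_zero, Matrix.one_apply, Finset.univ_eq_empty, Finset.prod_empty]
    rw [Finset.sum_eq_single s]
    · simp
    · intro b _ hb
      simp [hb]
    · simp
  | succ d ih =>
    have hcons : ∀ (a : V) (p : Fin (d + 1) → V),
        (if (Fin.cons a p : Fin (d + 2) → V) 0 = s ∧
            (Fin.cons a p : Fin (d + 2) → V) (Fin.last (d + 1)) = x then
          ∏ i : Fin (d + 1), E ((Fin.cons a p : Fin (d + 2) → V) i.castSucc)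
            ((Fin.cons a p : Fin (d + 2) → V) i.succ) else 0) =
        if a = s then if p (Fin.last d) = x then
          E a (p 0) * ∏ i : Fin d, E (p i.castSucc) (p i.succ) else 0 else 0 := by
      intro a p
      rw [← Fin.succ_last, Fin.cons_succ, Fin.cons_zero, ite_and, Fin.prod_univ_succ]
      rfl
    rw [pow_succ', Matrix.mul_apply, ← (Fin.consEquiv fun _ : Fin (d + 2) => V).sum_comp,
      Fintype.sum_prod_type]
    refine Eq.trans ?_ (Finset.sum_congr rfl fun a _ => Finset.sum_congr rfl fun p _ =>
      (hcons a p).symm)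
    rw [Finset.sum_eq_single_of_mem s (Finset.mem_univ s) fun a _ ha =>
      Finset.sum_eq_zero fun p _ => if_neg ha]
    simp_rw [ih, Finset.mul_sum]
    rw [Finset.sum_comm]
    refine Finset.sum_congr rfl fun p _ => ?_
    rw [Finset.sum_eq_single (p 0)]
    · simp
    · intro b _ hb
      simp [hb.symm]
    · simp

/-! ### Cutting a layered matrix product. -/

namespace Matrix

open MvPolynomial

/-- Sweeping a row vector through a layered product of matrices, while cutting it down to its
constant terms in every layer `k` with `t ∣ k + j`. -/
theorem exists_pow_apply_eq_sum_add_vecMul {F σ V : Type*} [Field F] [Fintype V] [DecidableEq V]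
    (E : Matrix V V (MvPolynomial σ F)) (layer : V → ℕ) {Δ : ℕ}
    (hE : ∀ u v, E u v ≠ 0 → layer v = layer u + 1) (hdeg : ∀ u v, (E u v).totalDegree ≤ Δ)
    {t : ℕ} (ht : 0 < t) (j : ℕ) (s x : V) (hs : layer s = 0) (k m : ℕ) :
    ∃ (P Q : V → MvPolynomial σ F) (R : MvPolynomial σ F) (w : V → MvPolynomial σ F),
      (∀ v, constantCoeff (P v) = 0) ∧ (∀ v, constantCoeff (Q v) = 0) ∧
      (∀ v, P v ≠ 0 → layer v ≤ k ∧ t ∣ layer v + j) ∧ R.totalDegree ≤ Δ * t ∧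
      (∀ v, w v ≠ 0 → layer v = k) ∧ (∀ v, (w v).totalDegree ≤ Δ * ((k + j) % t)) ∧
      (E ^ (k + m)) s x = ∑ v, P v * Q v + R + (w ᵥ* E ^ m) x := by
  -- `w` is the part of the row vector at layer `k` still to be propagated; its degree is controlled
  -- by `(k + j) % t`, which bounds the number of steps since the last cut.
  induction k generalizing m with
  | zero =>
    refine ⟨0, 0, 0, Pi.single s 1, by simp, by simp, by simp, by simp, ?_, ?_, ?_⟩
    · intro v hv
      by_cases h : v = s
      · rw [h, hs]
      · simp [h] at hv
    · intro v
      by_cases h : v = s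
      · subst h; simp
      · simp [h]
    · simp
  | succ k ih =>
    obtain ⟨P, Q, R, w, hP, hQ, hPC, hR, hw, hwdeg, heq⟩ := ih (m + 1)
    have hlayer : ∀ v, (w ᵥ* E) v ≠ 0 → layer v = k + 1 := by
      intro v hv
      obtain ⟨u, -, hu⟩ := Finset.exists_ne_zero_of_sum_ne_zero hv
      rw [hE u v (right_ne_zero_of_mul hu), hw u (left_ne_zero_of_mul hu)]
    have hstep : ∀ v, ((w ᵥ* E) v).totalDegree ≤ Δ * ((k + j) % t + 1) := by
      intro v
      refine totalDegree_finsetSum_le fun u _ => (totalDegree_mul _ _).trans ?_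
      rw [mul_add, mul_one]
      exact add_le_add (hwdeg u) (hdeg u v)
    have hstep' : ∀ v, ((w ᵥ* E) v).totalDegree ≤ Δ * t := fun v =>
      (hstep v).trans (Nat.mul_le_mul_left _ (Nat.mod_lt _ ht))
    rw [pow_succ', ← vecMul_vecMul] at heq
    by_cases hcut : t ∣ k + 1 + j
    · set w' := w ᵥ* E
      let a : V → F := fun v => constantCoeff (w' v)
      let b : V → F := fun v => constantCoeff ((E ^ m) v x)
      -- With `u` the remaining column, `w' u = (w' - a)(u - b) + (w' - a) b + a u`: a new product,
      -- a low-degree term for `R`, and a restart from constants. The old `P` vanishes on layer `k +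
      -- 1`, so there are no cross terms.
      refine ⟨fun v => P v + (w' v - C (a v)),
        fun v => if layer v = k + 1 then (E ^ m) v x - C (b v) else Q v,
        R + ∑ v, (w' v - C (a v)) * C (b v), fun v => C (a v), ?_, ?_, ?_, ?_, ?_, ?_, ?_⟩
      · intro v
        simp [hP, a]
      · intro v
        dsimp only
        split_ifs
        · simp [b]
        · exact hQ v
      · intro v hv
        by_cases hPv : P v = 0
        · have : w' v ≠ 0 := by
            intro h0
            simp [hPv, a, h0] at hv
          rw [hlayer v this]
          exact ⟨le_rfl, hcut⟩
        · exact ⟨(hPC v hPv).1.trans (Nat.le_succ k), (hPC v hPv).2⟩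
      · refine (totalDegree_add _ _).trans (max_le hR (totalDegree_finsetSum_le fun v _ => ?_))
        refine (totalDegree_mul _ _).trans ?_
        rw [totalDegree_C, add_zero]
        exact (totalDegree_sub_C_le _ _).trans (hstep' v)
      · intro v hv
        refine hlayer v fun h0 => hv ?_
        simp [a, w', h0]
      · simp
      · have hsum : ∑ v, (P v + (w' v - C (a v))) *
            (if layer v = k + 1 then (E ^ m) v x - C (b v) else Q v) =
            ∑ v, P v * Q v + ∑ v, (w' v - C (a v)) * ((E ^ m) v x - C (b v)) := by
          rw [← Finset.sum_add_distrib]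
          refine Finset.sum_congr rfl fun v _ => ?_
          split_ifs with hv
          · have : P v = 0 := by
              by_contra h
              have := (hPC v h).1
              omega
            rw [this]
            ring
          · have h0 : w' v = 0 := by
              by_contra h
              exact hv (hlayer v h)
            simp [a, h0]
        rw [add_assoc k 1 m, add_comm 1 m, heq, hsum]
        simp only [vecMul, dotProduct]
        have hsplit : ∑ v, w' v * (E ^ m) v x =
            ∑ v, (w' v - C (a v)) * ((E ^ m) v x - C (b v)) +
              ∑ v, (w' v - C (a v)) * C (b v) + ∑ v, C (a v) * (E ^ m) v x := by
          rw [← Finset.sum_add_distrib, ← Finset.sum_add_distrib]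
          exact Finset.sum_congr rfl fun v _ => by ring
        rw [hsplit]
        ring
    · refine ⟨P, Q, R, w ᵥ* E, hP, hQ,
        fun v hv => ⟨(hPC v hv).1.trans (Nat.le_succ k), (hPC v hv).2⟩, hR, hlayer, ?_, ?_⟩
      · intro v
        rw [add_right_comm] at hcut ⊢
        have hmod : (k + j + 1) % t = (k + j) % t + 1 := by
          rw [Nat.dvd_iff_mod_eq_zero, ← Nat.mod_add_mod] at hcut
          rw [← Nat.mod_add_mod]
          refine Nat.mod_eq_of_lt (lt_of_le_of_ne (Nat.mod_lt _ ht) fun h => hcut ?_)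
          exact (congrArg (· % t) h).trans (Nat.mod_self t)
        rw [hmod]
        exact hstep v
      · rw [add_assoc k 1 m, add_comm 1 m, heq]

end Matrix

/-! ### Application to branching programs. -/

namespace ABP

open MvPolynomial Matrix

variable {F σ V : Type*} [Field F] (A : ABP F σ V)

open Classical in
/-- The matrix of the edge labels, with entry `0` for pairs of vertices that are not edges. -/
noncomputable def labelMatrix : Matrix V V (MvPolynomial σ F) :=
  Matrix.of fun u v => if A.Adj u v then A.label u v else 0

open Classical in
theorem computed_eq_labelMatrix_pow [Fintype V] :
    A.computed = (A.labelMatrix ^ A.depth) A.start A.finish := by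
  rw [Matrix.pow_apply_eq_sum_walks, computed, Finset.sum_filter]
  refine Finset.sum_congr rfl fun p _ => ?_
  by_cases hend : p 0 = A.start ∧ p (Fin.last A.depth) = A.finish
  · rw [if_pos hend]
    by_cases hadj : ∀ i : Fin A.depth, A.Adj (p i.castSucc) (p i.succ)
    · rw [if_pos ⟨hend.1, hend.2, hadj⟩, weight]
      exact Finset.prod_congr rfl fun i _ => (if_pos (hadj i)).symm
    · rw [if_neg fun h => hadj h.2.2]
      obtain ⟨i, hi⟩ := not_forall.1 hadj
      exact (Finset.prod_eq_zero (Finset.mem_univ i) (if_neg hi)).symm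
  · rw [if_neg hend, if_neg fun h => hend ⟨h.1, h.2.1⟩]

/-- A program with `S` vertices and edge labels of degree at most `Δ` computes, up to terms of
degree at most `Δ t`, a sum of at most `S / t` products of polynomials without constant term. -/
theorem exists_computed_eq_sum_mul_add [Fintype V] {Δ : ℕ} (hA : A.LabelsDegreeLE Δ) {t : ℕ}
    (ht : 0 < t) : ∃ (C : Finset V) (P Q : V → MvPolynomial σ F) (R : MvPolynomial σ F),
      t * C.card ≤ A.size ∧ (∀ v, constantCoeff (P v) = 0) ∧ (∀ v, constantCoeff (Q v) = 0) ∧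
      R.totalDegree ≤ Δ * t ∧ A.computed = ∑ v ∈ C, P v * Q v + R := by
  classical
  obtain ⟨j, hj⟩ := Finset.exists_mul_card_dvd_add_le A.layer ht
  obtain ⟨P, Q, R, w, hP, hQ, hPC, hR, -, hw, heq⟩ :=
    Matrix.exists_pow_apply_eq_sum_add_vecMul A.labelMatrix A.layer (Δ := Δ)
      (fun u v h => A.layer_of_adj u v (by
        by_contra hadj
        exact h (if_neg hadj)))
      (fun u v => by
        simp only [labelMatrix, Matrix.of_apply]
        split_ifs with hadj
        · exact hA u v hadj
        · simp)
      ht j A.start A.finish ((A.layer_eq_zero_iff _).2 rfl) A.depth 0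
  -- With no steps left, the residual vector contributes just its low-degree entry at `finish`.
  refine ⟨Finset.univ.filter fun v => t ∣ A.layer v + j, P, Q, R + w A.finish, hj, hP, hQ,
    (totalDegree_add _ _).trans (max_le hR ((hw _).trans
      (Nat.mul_le_mul_left _ (Nat.mod_lt _ ht).le))), ?_⟩
  rw [A.computed_eq_labelMatrix_pow, Finset.sum_filter_of_ne
    fun v _ hv => (hPC v (left_ne_zero_of_mul hv)).2, ← add_assoc]
  simpa using heq

theorem sq_div_le_size {n : ℕ} [Fintype V] (A : ABP F (Fin n) V) (hn : ¬ ringChar F ∣ n) {Δ : ℕ}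
    (hΔ : 1 ≤ Δ) (hΔn : Δ < n) (hA : A.LabelsDegreeLE Δ)
    (h : A.computed = ∑ i : Fin n, X i ^ n) :
    (1 / 4 : ℝ) * ((n : ℝ) ^ 2 / (Δ : ℝ)) ≤ (A.size : ℝ) := by
  -- The largest `t` with `Δ * t < n`; since `t ≥ 1`, also `n ≤ 2 * (Δ * t)`. This factor 2 and the
  -- two factors per product give the constant 1/4.
  let t := (n - 1) / Δ
  have ht : 0 < t := Nat.div_pos (by omega) hΔ
  obtain ⟨C, P, Q, R, hC, hP, hQ, hR, heq⟩ := A.exists_computed_eq_sum_mul_add hA ht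
  have hmul : Δ * t ≤ n - 1 := Nat.mul_div_le _ _
  have hcard : n ≤ 2 * C.card := le_two_mul_card_of_sum_X_pow_eq (by omega)
    (fun h0 => hn ((ringChar.spec F n).1 h0)) C P Q R hP hQ (by omega) (h ▸ heq)
  have ht2 : n ≤ 2 * (Δ * t) := by
    have h1 : n - 1 < Δ * (t + 1) := Nat.lt_mul_div_succ (n - 1) hΔ
    have h2 : Δ ≤ Δ * t := Nat.le_mul_of_pos_right Δ ht
    rw [mul_add] at h1
    omega
  have hsq : n ^ 2 ≤ 4 * A.size * Δ := calc
    n ^ 2 = n * n := sq n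
    _ ≤ 2 * (Δ * t) * (2 * C.card) := Nat.mul_le_mul ht2 hcard
    _ = 4 * (t * C.card) * Δ := by ring
    _ ≤ 4 * A.size * Δ := by gcongr
  have hsq' : (n : ℝ) ^ 2 ≤ 4 * A.size * Δ := by exact_mod_cast hsq
  have hΔ' : (0 : ℝ) < Δ := by exact_mod_cast hΔ
  have := (div_le_iff₀ hΔ').2 hsq'
  linarith

end ABP

theorem theorem1p1 :
    ∃ c : ℝ, 0 < c ∧
      (∀ (F : Type*) [Field F] (n : ℕ), ¬ ringChar F ∣ n →
        ∀ (V : Type*) [Fintype V] (A : ABP F (Fin n) V), A.LabelsAffine →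
          A.computed = ∑ i : Fin n, MvPolynomial.X i ^ n →
            c * (n : ℝ) ^ 2 ≤ (A.size : ℝ)) ∧
      (∀ (F : Type*) [Field F] (n : ℕ), ¬ ringChar F ∣ n →
        ∀ (Δ : ℕ), 1 ≤ Δ → Δ < n →
          ∀ (V : Type*) [Fintype V] (A : ABP F (Fin n) V), A.LabelsDegreeLE Δ →
            A.computed = ∑ i : Fin n, MvPolynomial.X i ^ n →
              c * ((n : ℝ) ^ 2 / (Δ : ℝ)) ≤ (A.size : ℝ)) := by
  refine ⟨1 / 4, by norm_num, ?_, ?_⟩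
  · intro F _ n hn V _ A hA h
    rcases lt_or_ge 1 n with hn1 | hn1
    · simpa using A.sq_div_le_size hn le_rfl hn1 hA h
    -- For `n ≤ 1` the existence of a start vertex is enough.
    · have hsize : (1 : ℝ) ≤ A.size := by
        exact_mod_cast (Fintype.card_pos_iff.2 ⟨A.start⟩ : 0 < Fintype.card V)
      have hn' : (n : ℝ) ≤ 1 := by exact_mod_cast hn1
      nlinarith [n.cast_nonneg (α := ℝ)]
  · intro F _ n hn Δ hΔ hΔn V _ A hA h
    exact A.sq_div_le_size hn hΔ hΔn hA h
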